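/- Let $n\ge 1$ and let $\Omega\subset\mathbb C^n$ be a smooth, bounded, strictly pseudoconvex domain, with a smooth defining function $\rho$ ($\Omega=\{\rho<0\}$, $\mathbf b\Omega=\{\rho=0\}$) such that $|\nabla\rho|=1$ on $\mathbf b\Omega$. Let $\mathrm{Vol}$ (or $dV$) denote Lebesgue measure and $\sigma$ the normalized surface measure on $\mathbf b\Omega$. For $q$ in a neighbourhood of $\mathbf b\Omega$ and $0<r<r_0$, let $z=(z_1,\dots,z_n)$ be holomorphic coordinates centered at $q$ (depending on $q$ and $r$, defined on balls about $q$ of a fixed radius, bi-Lipschitz uniformly in $q$ and $r$), and let $D(q,r)=\{|z_j|<\tau_j(q,r),\ j=1,\dots,n\}$ be a maximal polydisc in these coordinates on which $|\rho(\cdot)-\rho(q)|<r$, where $\tau_1(q,r)=r$ and $\tau_j(q,r)\approx r^{1/2}$ for $j\ge2$, uniformly in $q$ and $r$. For $z\in\mathbf b\Omega$ put $\beta(z,r)=D(z,r)\cap\mathbf b\Omega$ if $r<r_0$ and $\beta(z,r)=\mathbf b\Omega$ if $r\ge r_0$; let $d(z,z')=\inf\{r>0: z'\in \beta(z,r)\}$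 and $B(z,r)=\{w\in\mathbf b\Omega: d(z,w)<r\}$. Let $\mathcal D=\bigcup_{k\ge0}\mathcal D_k$ be a dyadic grid on $\mathbf b\Omega$ with constants $\mathfrak C>0$ and $0<\delta,\epsilon<1$: each $\mathcal D_k$ is a finite family of Borel subsets of $\mathbf b\Omega$ with union $\mathbf b\Omega$, and $\mathcal D_0=\{\mathbf b\Omega\}$; two cubes of $\mathcal D$ that intersect are nested; every $Q\in\mathcal D_k$ contains some $Q'\in\mathcal D_{k+1}$ (a child), and every $Q\in\mathcal D_{k+1}$ is contained in exactly one element of $\mathcal D_k$; for $k\ge1$, $\sigma(Q')\ge\epsilon\,\sigma(Q)$ whenever $Q'\in\mathcal D_{k+1}$ is a child of $Q\in\mathcal D_k$, and every $Q\in\mathcal D_k$ has a center $c(Q)\in\mathbf b\Omega$ with $B(c(Q),\delta^k)\subset Q\subset B(c(Q),\mathfrak C\delta^k)$. The sidelength of $Q\in\mathcal D_k$ is $\ell(Q)=\delta^k$. Let $\varepsilon_0>0$ be such that every $z$ with $\mathrm{dist}(z,\mathbf b\Omega)<\varepsilon_0$ has a unique nearest point $\pi(z)\in\mathbf b\Omega$.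 For $Q\in\mathcal D_k$, $k\ge1$, the tent over $Q$ is $$T(Q)=\{w\in\Omega:\ \pi(w)\in Q,\ |\pi(w)-w|\le\ell(Q)\}\quad\text{if }\ell(Q)<\varepsilon_0,\qquad T(Q)=\Omega\quad\text{if }\ell(Q)\ge\varepsilon_0 .$$ Let $\mathcal T=\{\Omega\}\cup\{T(Q): Q\in\mathcal D_k,\ k\ge1\}$, and for $0<\alpha<1$ let $$\mathcal M_{\mathcal T,\alpha}f(z)=\sup_{z\in T\in\mathcal T}\mathrm{Vol}(T)^{\alpha}\langle f\rangle_T,\qquad \langle f\rangle_T=\frac1{\mathrm{Vol}(T)}\int_T|f|\,dV .$$ Then for all $0<\alpha<1$ and $q>p>1$ with $\frac1p-\frac1q=\alpha$, the operator $\mathcal M_{\mathcal T,\alpha}$ is bounded from $L^p(\Omega)$ to $L^q(\Omega)$: there is a constant $C$ such that for every $f\in L^p(\Omega)$, $\mathcal M_{\mathcal T,\alpha}f\in L^q(\Omega)$ and $\|\mathcal M_{\mathcal T,\alpha}f\|_{L^q(\Omega)}\le C\|f\|_{L^p(\Omega)}$. -/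

import Mathlib

open MeasureTheory Set Metric
open scoped ENNReal NNReal ContDiff

noncomputable section

namespace StrictlyPseudoconvex

/-- The space `ℂⁿ` with its Euclidean norm and Lebesgue measure. -/
abbrev Cn (n : ℕ) : Type := EuclideanSpace ℂ (Fin n)

/-- `ρ` is a smooth defining function of `Ω`: `ρ < 0` exactly on `Ω`, `ρ = 0` exactly on the
boundary (so `ρ > 0` outside the closure), and the differential of `ρ` does not vanish on the
boundary. -/
structure IsDefiningFunction {n : ℕ} (Ω : Set (Cn n)) (ρ : Cn n → ℝ) : Prop where
  contDiff : ContDiff ℝ ∞ ρ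
  eq_neg : Ω = {z | ρ z < 0}
  frontier_eq : frontier Ω = {z | ρ z = 0}
  fderiv_ne_zero : ∀ z ∈ frontier Ω, fderiv ℝ ρ z ≠ 0

/-- The Levi form `∑ⱼₖ (∂²ρ / ∂zⱼ∂z̄ₖ)(z) ξⱼ ξ̄ₖ`, written through the real second derivative:
it equals `(D²ρ(z)(ξ, ξ) + D²ρ(z)(iξ, iξ)) / 4`. -/
def leviForm {n : ℕ} (ρ : Cn n → ℝ) (z ξ : Cn n) : ℝ :=
  (fderiv ℝ (fderiv ℝ ρ) z ξ ξ
    + fderiv ℝ (fderiv ℝ ρ) z (Complex.I • ξ) (Complex.I • ξ)) / 4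

/-- The vector `ξ` is complex tangential at `z`: `∑ⱼ (∂ρ / ∂zⱼ)(z) ξⱼ = 0`, that is, both `ξ` and
`iξ` are annihilated by the real differential of `ρ`. -/
def IsComplexTangent {n : ℕ} (ρ : Cn n → ℝ) (z ξ : Cn n) : Prop :=
  fderiv ℝ ρ z ξ = 0 ∧ fderiv ℝ ρ z (Complex.I • ξ) = 0

/-- Smooth, bounded, strictly pseudoconvex domains in `ℂⁿ`. -/
structure IsSmoothBoundedStrictlyPseudoconvex {n : ℕ} (Ω : Set (Cn n)) : Prop where
  isOpen : IsOpen Ω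
  isConnected : IsConnected Ω
  isBounded : Bornology.IsBounded Ω
  exists_defining : ∃ ρ : Cn n → ℝ, IsDefiningFunction Ω ρ ∧
    ∀ z ∈ frontier Ω, ∀ ξ : Cn n, ξ ≠ 0 → IsComplexTangent ρ z ξ → 0 < leviForm ρ z ξ

/-- The polydisc centred at the origin with polyradius `τ`. -/
def polydisc {n : ℕ} (τ : Fin n → ℝ) : Set (Cn n) :=
  {ζ | ∀ j, ‖ζ j‖ < τ j}

/-- In the coordinates `Φ` (centred at `q`, defined on the ball of radius `R` about `q`), the
polydisc of polyradius `τ` lies in the coordinate patch, and `ρ` changes by less than `r` from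
its value at `q` on it. -/
def IsAdmissible {n : ℕ} (ρ : Cn n → ℝ) (Φ : Cn n → Cn n) (R : ℝ) (q : Cn n) (r : ℝ)
    (τ : Fin n → ℝ) : Prop :=
  (∀ j, 0 < τ j) ∧ polydisc τ ⊆ Φ '' ball q R ∧
    ∀ z ∈ ball q R, Φ z ∈ polydisc τ → |ρ z - ρ q| < r

/-- A choice, for `q` in a neighbourhood of the boundary of `Ω` and small `r > 0`, of holomorphic
coordinates centred at `q` and of a maximal polydisc in these coordinates on which `ρ` changes by
less than `r`, with `τ₁(q, r) = r` and `τⱼ(q, r) ≈ r ^ (1 / 2)` for the other `j`. The coordinates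
live on balls of a fixed radius and are bi-Lipschitz, and all constants are uniform in `q` and `r`.
The first coordinate has index `0 : Fin n`. -/
structure PolydiscSystem {n : ℕ} [NeZero n] (Ω : Set (Cn n)) (ρ : Cn n → ℝ) where
  /-- the neighbourhood of the boundary in which the centres lie -/
  nhd : Set (Cn n)
  isOpen_nhd : IsOpen nhd
  frontier_subset : frontier Ω ⊆ nhd
  /-- the polydiscs are defined for `0 < r < r₀` -/
  r₀ : ℝ
  r₀_pos : 0 < r₀
  /-- radius of the coordinate patches -/
  R : ℝ
  R_pos : 0 < R
  /-- the uniform comparison constant -/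
  K : ℝ
  one_le_K : 1 ≤ K
  /-- the coordinates `z = (z₁, …, zₙ)` used for the centre `q` and the scale `r` -/
  coord : Cn n → ℝ → Cn n → Cn n
  /-- the polyradius `τ(q, r)` -/
  τ : Cn n → ℝ → Fin n → ℝ
  coord_holomorphic : ∀ q ∈ nhd, ∀ r, 0 < r → r < r₀ →
    DifferentiableOn ℂ (coord q r) (ball q R)
  coord_center : ∀ q ∈ nhd, ∀ r, 0 < r → r < r₀ → coord q r q = 0
  coord_biLipschitz : ∀ q ∈ nhd, ∀ r, 0 < r → r < r₀ → ∀ z ∈ ball q R, ∀ w ∈ ball q R,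
    K⁻¹ * dist z w ≤ dist (coord q r z) (coord q r w) ∧
      dist (coord q r z) (coord q r w) ≤ K * dist z w
  τ_zero : ∀ q ∈ nhd, ∀ r, 0 < r → r < r₀ → τ q r 0 = r
  τ_ne_zero : ∀ q ∈ nhd, ∀ r, 0 < r → r < r₀ → ∀ j, j ≠ 0 →
    K⁻¹ * √r ≤ τ q r j ∧ τ q r j ≤ K * √r
  τ_maximal : ∀ q ∈ nhd, ∀ r, 0 < r → r < r₀ →
    Maximal (IsAdmissible ρ (coord q r) R q r) (τ q r)

namespace PolydiscSystem

variable {n : ℕ} [NeZero n] {Ω : Set (Cn n)} {ρ : Cn n → ℝ} (P : PolydiscSystem Ω ρ)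

/-- The polydisc `D(q, r)`. -/
def disc (q : Cn n) (r : ℝ) : Set (Cn n) :=
  {z | z ∈ ball q P.R ∧ P.coord q r z ∈ polydisc (P.τ q r)}

open Classical in
/-- The set `B(z, r) = D(z, r) ∩ bΩ` for small `r`; at the scales `r ≥ r₀`, where there is no
polydisc, it is all of `bΩ`. -/
def preBall (z : Cn n) (r : ℝ) : Set (Cn n) :=
  if r < P.r₀ then P.disc z r ∩ frontier Ω else frontier Ω

/-- The quasi-distance `d(z, z') = inf {r > 0 | z' ∈ B(z, r)}` on the boundary. -/
def d (z z' : Cn n) : ℝ :=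
  sInf {r : ℝ | 0 < r ∧ z' ∈ P.preBall z r}

/-- The ball `{w ∈ bΩ | d(z, w) < r}` of the quasi-distance `d`. -/
def bdryBall (z : Cn n) (r : ℝ) : Set (Cn n) :=
  {w ∈ frontier Ω | P.d z w < r}

end PolydiscSystem

/-- The normalized surface measure on the boundary of `Ω`: the `(2n - 1)`-dimensional Hausdorff
measure on the boundary, divided by its total mass. -/
def surfaceMeasure {n : ℕ} (Ω : Set (Cn n)) : Measure (Cn n) :=
  (Measure.hausdorffMeasure (2 * (n : ℝ) - 1) (frontier Ω))⁻¹ •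
    (Measure.hausdorffMeasure (2 * (n : ℝ) - 1) : Measure (Cn n)).restrict (frontier Ω)

/-- A dyadic grid on the boundary of `Ω`, relative to the quasi-distance of a polydisc system.
The cubes of generation `k` have sidelength `δ ^ k`, and the generation `0` is `{bΩ}`. -/
structure DyadicGrid {n : ℕ} [NeZero n] {Ω : Set (Cn n)} {ρ : Cn n → ℝ}
    (P : PolydiscSystem Ω ρ) where
  /-- the set of dyadic cubes of each generation -/
  cubes : ℕ → Set (Set (Cn n))
  /-- the centre of a cube of a given generation -/
  center : ℕ → Set (Cn n) → Cn n
  /-- the constant in the outer ball of the sandwich property -/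
  C : ℝ
  /-- the ratio of consecutive sidelengths -/
  δ : ℝ
  /-- the constant comparing a cube with its children -/
  ε : ℝ
  C_pos : 0 < C
  δ_pos : 0 < δ
  δ_lt_one : δ < 1
  ε_pos : 0 < ε
  ε_lt_one : ε < 1
  cubes_zero : cubes 0 = {frontier Ω}
  finite_cubes : ∀ k, (cubes k).Finite
  measurableSet_cube : ∀ k, ∀ Q ∈ cubes k, MeasurableSet Q
  sUnion_cubes : ∀ k, ⋃₀ cubes k = frontier Ω
  nested : ∀ k l, ∀ Q₁ ∈ cubes k, ∀ Q₂ ∈ cubes l, (Q₁ ∩ Q₂).Nonempty → Q₁ ⊆ Q₂ ∨ Q₂ ⊆ Q₁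
  exists_child : ∀ k, ∀ Q ∈ cubes k, ∃ Q' ∈ cubes (k + 1), Q' ⊆ Q
  unique_parent : ∀ k, ∀ Q ∈ cubes (k + 1), ∃! Q', Q' ∈ cubes k ∧ Q ⊆ Q'
  measure_child : ∀ k, 1 ≤ k → ∀ Q₁ ∈ cubes k, ∀ Q₂ ∈ cubes (k + 1), Q₂ ⊆ Q₁ →
    ENNReal.ofReal ε * surfaceMeasure Ω Q₁ ≤ surfaceMeasure Ω Q₂
  center_mem : ∀ k, 1 ≤ k → ∀ Q ∈ cubes k, center k Q ∈ frontier Ω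
  sandwich : ∀ k, 1 ≤ k → ∀ Q ∈ cubes k,
    P.bdryBall (center k Q) (δ ^ k) ⊆ Q ∧ Q ⊆ P.bdryBall (center k Q) (C * δ ^ k)

/-- On the `ε₀`-neighbourhood of the boundary of `Ω`, the nearest-point projection to the boundary
is well defined. -/
def IsProjectionRadius {n : ℕ} (Ω : Set (Cn n)) (ε₀ : ℝ) : Prop :=
  0 < ε₀ ∧ ∀ z : Cn n, infDist z (frontier Ω) < ε₀ →
    ∃! p, p ∈ frontier Ω ∧ dist z p = infDist z (frontier Ω)

open Classical in
/-- The nearest-point projection `π` to the boundary of `Ω` (some nearest point, where there are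
several; only its values on a set where the nearest point is unique are used). -/
def bdryProj {n : ℕ} (Ω : Set (Cn n)) (z : Cn n) : Cn n :=
  if h : ∃ p, p ∈ frontier Ω ∧ dist z p = infDist z (frontier Ω) then h.choose else z

open Classical in
/-- The tent over a set `S` of the boundary of sidelength `ℓ`. -/
def tent {n : ℕ} (Ω : Set (Cn n)) (ε₀ : ℝ) (S : Set (Cn n)) (ℓ : ℝ) : Set (Cn n) :=
  if ℓ < ε₀ then {w ∈ Ω | bdryProj Ω w ∈ S ∧ dist (bdryProj Ω w) w ≤ ℓ} else Ω

/-- The dyadic extension of a grid: the tents over the cubes of the generations `k ≥ 1`, and `Ω`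
itself. -/
def dyadicExtension {n : ℕ} [NeZero n] {Ω : Set (Cn n)} {ρ : Cn n → ℝ} {P : PolydiscSystem Ω ρ}
    (G : DyadicGrid P) (ε₀ : ℝ) : Set (Set (Cn n)) :=
  {T | T = Ω ∨ ∃ k, 1 ≤ k ∧ ∃ Q ∈ G.cubes k, T = tent Ω ε₀ Q (G.δ ^ k)}

/-- The fractional maximal operator `sup_{z ∈ T ∈ 𝒯} Vol(T) ^ α ⟨f⟩_T` over a family `𝒯` of sets,
where `⟨f⟩_T` is the mean of `|f|` over `T`. -/
def fractionalMaximal {n : ℕ} (𝒯 : Set (Set (Cn n))) (α : ℝ) (f : Cn n → ℂ) (z : Cn n) : ℝ≥0∞ :=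
  ⨆ T ∈ 𝒯, ⨆ _ : z ∈ T, volume T ^ α * ⨍⁻ w in T, ‖f w‖ₑ ∂volume

end StrictlyPseudoconvex

end

/-!
The tents form a countable family `𝒯` of measurable subsets of `Ω` that is laminar: two tents that
meet are nested. This is inherited from the dyadic cubes, since a point of two tents projects into
both cubes, and the tent over the smaller cube, which has the smaller sidelength, lies in the other
one (`isLaminar_dyadicExtension`). Measurability holds because the nearest-point projection is
Borel where the nearest point is unique (`measurable_bdryProj_restrict`).

For a countable laminar family the maximal function `M` satisfies the weak-type `(1, 1)` inequality
with constant one, for any finite measure: a superlevel set is an increasing limit of finite unions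
of members with large average, and each finite union is the disjoint union of its maximal members
(`mul_measure_lt_maximalAverage_le`). No doubling property is
involved. Truncating at half the level and integrating over the levels gives the
bound of `M` on `L^p` for `p > 1` (`lintegral_maximalAverage_rpow_le`).

The fractional case follows from the pointwise estimate of Hedberg
(`iSup_rpow_mul_setLAverage_rpow_le`): writing
`(μ(T) ^ α ⟨f⟩_T) ^ q = (μ(T) ⟨f⟩_T ^ p) ^ ((q - p) / p) * ⟨f⟩_T ^ p`, the first factor is at most
`‖f‖_p ^ (q - p)` by Hölder's inequality and the second at most `(M f) ^ p`, whose integral is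
controlled by `‖f‖_p ^ p`.
-/

namespace StrictlyPseudoconvex

/-! ### The maximal function of a laminar family -/

section Maximal

variable {X : Type*} [MeasurableSpace X] {μ : Measure X} {𝒯 : Set (Set X)}

/-- The maximal function `sup_{x ∈ T ∈ 𝒯} ⨍_T g` of a nonnegative function over a family of
sets. -/
noncomputable def maximalAverage (μ : Measure X) (𝒯 : Set (Set X)) (g : X → ℝ≥0∞) (x : X) : ℝ≥0∞ :=
  ⨆ T ∈ 𝒯, ⨆ _ : x ∈ T, ⨍⁻ w in T, g w ∂μ

/-- A family of sets is laminar if any two of its members that meet are nested. -/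
def IsLaminar (𝒯 : Set (Set X)) : Prop :=
  ∀ S ∈ 𝒯, ∀ T ∈ 𝒯, (S ∩ T).Nonempty → S ⊆ T ∨ T ⊆ S

lemma measurable_iSup_mem (h𝒯 : 𝒯.Countable) (hm : ∀ T ∈ 𝒯, MeasurableSet T)
    (c : Set X → ℝ≥0∞) : Measurable fun x ↦ ⨆ T ∈ 𝒯, ⨆ _ : x ∈ T, c T := by
  classical
  refine Measurable.biSup 𝒯 h𝒯 fun T hT ↦ ?_
  have : (fun x ↦ ⨆ _ : x ∈ T, c T) = T.indicator fun _ ↦ c T := by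
    ext x
    by_cases hx : x ∈ T <;> simp [hx]
  rw [this]
  exact measurable_const.indicator (hm T hT)

lemma mul_measure_le_setLIntegral_of_lt_setLAverage [IsFiniteMeasure μ] {T : Set X}
    {g : X → ℝ≥0∞} {t : ℝ≥0∞} (h : t < ⨍⁻ w in T, g w ∂μ) : t * μ T ≤ ∫⁻ w in T, g w ∂μ := by
  rw [← measure_mul_setLAverage g (measure_ne_top μ T), mul_comm]
  gcongr

/-- Over finitely many sets of a laminar family, the union is the disjoint union of the maximal
ones, so a lower bound on the averages passes to the union. -/
lemma mul_measure_biUnion_finset_le [IsFiniteMeasure μ] (hlam : IsLaminar 𝒯)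
    (hm : ∀ T ∈ 𝒯, MeasurableSet T) {g : X → ℝ≥0∞} {t : ℝ≥0∞} (s : Finset (Set X))
    (hs : ∀ T ∈ s, T ∈ 𝒯 ∧ t < ⨍⁻ w in T, g w ∂μ) :
    t * μ (⋃ T ∈ s, T) ≤ ∫⁻ w, g w ∂μ := by
  classical
  set m : Finset (Set X) := s.filter fun T ↦ Maximal (· ∈ s) T with hmdef
  have hms : ∀ T ∈ m, T ∈ s := fun T hT ↦ (Finset.mem_filter.1 hT).1
  have hcover : (⋃ T ∈ s, T) ⊆ ⋃ T ∈ m, T := by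
    refine iUnion₂_subset fun T hT ↦ ?_
    obtain ⟨S, hTS, hS⟩ := s.exists_le_maximal hT
    exact Subset.trans hTS (subset_biUnion_of_mem (u := id)
      (Finset.mem_coe.2 (Finset.mem_filter.2 ⟨hS.prop, hS⟩)))
  have hdisj : (m : Set (Set X)).PairwiseDisjoint id := by
    intro S hS T hT hne
    by_contra hnd
    have hS' := (Finset.mem_filter.1 (Finset.mem_coe.1 hS)).2
    have hT' := (Finset.mem_filter.1 (Finset.mem_coe.1 hT)).2
    rcases hlam S (hs S hS'.prop).1 T (hs T hT'.prop).1
      (not_disjoint_iff_nonempty_inter.1 hnd) with h | h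
    · exact hne (hS'.eq_of_le hT'.prop h)
    · exact hne (hT'.eq_of_le hS'.prop h).symm
  calc t * μ (⋃ T ∈ s, T) ≤ t * ∑ T ∈ m, μ T := by
        gcongr
        exact (measure_mono hcover).trans (measure_biUnion_finset_le _ _)
    _ = ∑ T ∈ m, t * μ T := Finset.mul_sum ..
    _ ≤ ∑ T ∈ m, ∫⁻ w in T, g w ∂μ := Finset.sum_le_sum fun T hT ↦
        mul_measure_le_setLIntegral_of_lt_setLAverage (hs T (hms T hT)).2
    _ = ∫⁻ w in ⋃ T ∈ m, id T, g w ∂μ :=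
        (lintegral_biUnion_finset hdisj (fun T hT ↦ hm T (hs T (hms T hT)).1) _).symm
    _ ≤ ∫⁻ w, g w ∂μ := setLIntegral_le_lintegral _ _

/-- The weak-type `(1, 1)` inequality for a countable laminar family, with constant one. No
doubling property of the measure is needed. -/
lemma mul_measure_lt_maximalAverage_le [IsFiniteMeasure μ] (h𝒯 : 𝒯.Countable)
    (hlam : IsLaminar 𝒯) (hm : ∀ T ∈ 𝒯, MeasurableSet T) (g : X → ℝ≥0∞) (t : ℝ≥0∞) :
    t * μ {x | t < maximalAverage μ 𝒯 g x} ≤ ∫⁻ w, g w ∂μ := by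
  classical
  set S : Set (Set X) := {T ∈ 𝒯 | t < ⨍⁻ w in T, g w ∂μ} with hS
  have hset : {x | t < maximalAverage μ 𝒯 g x} = ⋃₀ S := by
    ext x
    simp only [maximalAverage, mem_ofPred_eq, lt_iSup_iff, mem_sUnion, hS, exists_prop]
    tauto
  rw [hset]
  rcases S.eq_empty_or_nonempty with h0 | hne
  · simp [h0]
  obtain ⟨e, he⟩ := (h𝒯.mono (sep_subset _ _) : S.Countable).exists_eq_range hne
  have heS : ∀ i, e i ∈ S := fun i ↦ he ▸ mem_range_self i
  rw [he, sUnion_range, measure_iUnion_eq_iSup_accumulate, ENNReal.mul_iSup]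
  refine iSup_le fun n ↦ ?_
  have hacc : accumulate e n = ⋃ T ∈ (Finset.range (n + 1)).image e, T := by
    ext x
    simp [mem_accumulate]
  rw [hacc]
  refine mul_measure_biUnion_finset_le hlam hm _ fun T hT ↦ ?_
  obtain ⟨i, -, rfl⟩ := Finset.mem_image.1 hT
  exact heS i

lemma maximalAverage_lt_top_ae [IsFiniteMeasure μ] (h𝒯 : 𝒯.Countable)
    (hlam : IsLaminar 𝒯) (hm : ∀ T ∈ 𝒯, MeasurableSet T) {g : X → ℝ≥0∞}
    (hg : ∫⁻ w, g w ∂μ ≠ ⊤) : ∀ᵐ x ∂μ, maximalAverage μ 𝒯 g x < ⊤ := by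
  have h : ∀ k : ℕ, (k : ℝ≥0∞) * μ {x | maximalAverage μ 𝒯 g x = ⊤} ≤ ∫⁻ w, g w ∂μ := by
    intro k
    refine le_trans ?_ (mul_measure_lt_maximalAverage_le h𝒯 hlam hm g k)
    refine mul_le_mul_right (measure_mono fun x (hx : _ = ⊤) ↦ ?_) _
    simp [hx]
  have h2 : ⊤ * μ {x | maximalAverage μ 𝒯 g x = ⊤} ≤ ∫⁻ w, g w ∂μ := by
    generalize μ {x | maximalAverage μ 𝒯 g x = ⊤} = m at h
    rw [← ENNReal.iSup_natCast, ENNReal.iSup_mul]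
    exact iSup_le h
  have h0 : μ {x | maximalAverage μ 𝒯 g x = ⊤} = 0 := by
    by_contra h0
    rw [ENNReal.top_mul h0] at h2
    exact hg (top_le_iff.1 h2)
  rw [ae_iff]
  simpa [lt_top_iff_ne_top] using h0

/-- The truncated weak-type inequality: only the part of `g` above half the level contributes. -/
lemma mul_measure_lt_maximalAverage_le_truncated [IsFiniteMeasure μ] (h𝒯 : 𝒯.Countable)
    (hlam : IsLaminar 𝒯) (hm : ∀ T ∈ 𝒯, MeasurableSet T) {g : X → ℝ≥0∞}
    (hg : AEMeasurable g μ) (t : ℝ≥0∞) :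
    t * μ {x | t < maximalAverage μ 𝒯 g x} ≤ 2 * ∫⁻ w in {x | t < 2 * g x}, g w ∂μ := by
  classical
  set A : Set X := {x | t < 2 * g x} with hA
  have hAm : NullMeasurableSet A μ :=
    nullMeasurableSet_lt aemeasurable_const (hg.const_mul 2)
  have hsplit : ∀ x, g x ≤ A.indicator g x + t / 2 := by
    intro x
    by_cases hx : x ∈ A
    · simp [hx]
    · have hx' : 2 * g x ≤ t := not_lt.1 hx
      rw [indicator_of_notMem hx, zero_add, ENNReal.le_div_iff_mul_le (by simp) (by simp), mul_comm]
      exact hx'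
  have hmax : ∀ x, maximalAverage μ 𝒯 g x ≤ maximalAverage μ 𝒯 (A.indicator g) x + t / 2 := by
    intro x
    refine iSup₂_le fun T hT ↦ iSup_le fun hx ↦ ?_
    calc ⨍⁻ w in T, g w ∂μ ≤ ⨍⁻ w in T, (A.indicator g w + t / 2) ∂μ :=
          setLAverage_mono_ae T (Filter.Eventually.of_forall hsplit)
      _ = ⨍⁻ w in T, A.indicator g w ∂μ + ⨍⁻ w in T, t / 2 ∂μ := by
          simp only [setLAverage_eq]
          rw [lintegral_add_right _ measurable_const, ENNReal.add_div]
      _ ≤ _ := by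
          gcongr
          · exact le_iSup₂_of_le T hT (le_iSup_of_le hx le_rfl)
          · exact (setLAverage_le_essSup _ _).trans
              (essSup_le_of_ae_le _ (Filter.Eventually.of_forall fun _ ↦ le_rfl))
  have hsub : {x | t < maximalAverage μ 𝒯 g x} ⊆
      {x | t / 2 < maximalAverage μ 𝒯 (A.indicator g) x} := by
    intro x hx
    simp only [mem_ofPred_eq] at hx ⊢
    by_contra hcon
    refine absurd (hx.trans_le (hmax x)) (not_lt.2 ?_)
    calc _ ≤ t / 2 + t / 2 := by gcongr; exact not_lt.1 hcon
      _ = t := ENNReal.add_halves t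
  calc t * μ {x | t < maximalAverage μ 𝒯 g x}
      ≤ t * μ {x | t / 2 < maximalAverage μ 𝒯 (A.indicator g) x} := by gcongr
    _ = 2 * (t / 2 * μ {x | t / 2 < maximalAverage μ 𝒯 (A.indicator g) x}) := by
        rw [← mul_assoc, ENNReal.mul_div_cancel (by simp) (by simp)]
    _ ≤ 2 * ∫⁻ w, A.indicator g w ∂μ := by
        gcongr
        exact mul_measure_lt_maximalAverage_le h𝒯 hlam hm _ _
    _ = 2 * ∫⁻ w in A, g w ∂μ := by rw [lintegral_indicator₀ hAm]

/-- The constant of the strong-type `(p, p)` inequality, given by the layer-cake integration of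
the truncated weak-type inequality. -/
noncomputable def maximalConst (p : ℝ) : ℝ≥0 :=
  Real.toNNReal p * (2 * ((Real.toNNReal (p - 1))⁻¹ * Real.toNNReal (2 ^ (p - 1))))

/-- The strong-type `(p, p)` inequality for a countable laminar family. -/
lemma lintegral_maximalAverage_rpow_le [IsFiniteMeasure μ] (h𝒯 : 𝒯.Countable)
    (hlam : IsLaminar 𝒯) (hm : ∀ T ∈ 𝒯, MeasurableSet T) {E : Type*} [NormedAddCommGroup E]
    {f : X → E} (hf : Integrable f μ) {p : ℝ} (hp : 1 < p) :
    ∫⁻ x, maximalAverage μ 𝒯 (fun w ↦ ‖f w‖ₑ) x ^ p ∂μ ≤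
      maximalConst p * ∫⁻ x, ‖f x‖ₑ ^ p ∂μ := by
  have hp1 : 0 < p - 1 := by linarith
  set M := maximalAverage μ 𝒯 (fun w ↦ ‖f w‖ₑ) with hM
  have hMm : Measurable M := measurable_iSup_mem h𝒯 hm _
  have hMfin : ∀ᵐ x ∂μ, M x < ⊤ := maximalAverage_lt_top_ae h𝒯 hlam hm hf.2.ne
  have hfm : AEMeasurable (fun w ↦ ‖f w‖ₑ) μ := hf.1.enorm
  set ν := μ.withDensity fun w ↦ ‖f w‖ₑ with hν
  -- the layer-cake formula for the maximal function
  have h1 : ∫⁻ x, M x ^ p ∂μ = ENNReal.ofReal p *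
      ∫⁻ t in Ioi (0 : ℝ), μ {x | t < (M x).toReal} * ENNReal.ofReal (t ^ (p - 1)) := by
    rw [← lintegral_rpow_eq_lintegral_meas_lt_mul μ
      (Filter.Eventually.of_forall fun x ↦ ENNReal.toReal_nonneg)
      hMm.ennreal_toReal.aemeasurable (by linarith)]
    refine lintegral_congr_ae ?_
    filter_upwards [hMfin] with x hx
    rw [← ENNReal.ofReal_rpow_of_nonneg ENNReal.toReal_nonneg (by linarith),
      ENNReal.ofReal_toReal hx.ne]
  -- the layer-cake formula for `2‖f‖`, with exponent `p - 1`, in the measure of density `‖f‖`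
  have h2 : ENNReal.ofReal (p - 1) *
      ∫⁻ t in Ioi (0 : ℝ), ν {x | t < 2 * ‖f x‖} * ENNReal.ofReal (t ^ (p - 1 - 1)) =
      ENNReal.ofReal (2 ^ (p - 1)) * ∫⁻ x, ‖f x‖ₑ ^ p ∂μ := by
    rw [← lintegral_rpow_eq_lintegral_meas_lt_mul ν
      (Filter.Eventually.of_forall fun x ↦ by positivity)
      ((hf.1.norm.aemeasurable.const_mul 2).mono_ac (withDensity_absolutelyContinuous _ _)) hp1,
      lintegral_withDensity_eq_lintegral_mul₀ hfm
        ((hf.1.norm.aemeasurable.const_mul 2).pow_const _).ennreal_ofReal,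
      ← lintegral_const_mul'' _ (hfm.pow_const _)]
    refine lintegral_congr fun x ↦ ?_
    rw [Pi.mul_apply, Real.mul_rpow (by norm_num) (norm_nonneg _),
      ENNReal.ofReal_mul (by positivity),
      ← ENNReal.ofReal_rpow_of_nonneg (norm_nonneg _) hp1.le, ofReal_norm, mul_left_comm]
    congr 1
    nth_rewrite 1 [← ENNReal.rpow_one ‖f x‖ₑ]
    rw [← ENNReal.rpow_add_of_nonneg _ _ zero_le_one hp1.le]
    congr 1
    ring
  have h3 : ∫⁻ t in Ioi (0 : ℝ), μ {x | t < (M x).toReal} * ENNReal.ofReal (t ^ (p - 1)) ≤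
      2 * ∫⁻ t in Ioi (0 : ℝ), ν {x | t < 2 * ‖f x‖} * ENNReal.ofReal (t ^ (p - 1 - 1)) := by
    rw [← lintegral_const_mul' _ _ (by simp)]
    refine setLIntegral_mono' measurableSet_Ioi fun t ht ↦ ?_
    have ht0 : 0 < t := ht
    have hsub : {x | t < (M x).toReal} ⊆ {x | ENNReal.ofReal t < M x} := fun x hx ↦
      ENNReal.ofReal_lt_iff_lt_toReal ht0.le
        (fun h ↦ by simp [h] at hx; linarith) |>.2 hx
    have hset : {x | ENNReal.ofReal t < 2 * ‖f x‖ₑ} = {x | t < 2 * ‖f x‖} := by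
      ext x
      simp only [mem_ofPred_eq]
      rw [← ofReal_norm, ← ENNReal.ofReal_ofNat 2, ← ENNReal.ofReal_mul (by norm_num),
        ENNReal.ofReal_lt_ofReal_iff_of_nonneg ht0.le]
    have hweak := mul_measure_lt_maximalAverage_le_truncated h𝒯 hlam hm hfm
      (ENNReal.ofReal t)
    rw [hset, ← withDensity_apply' (fun w ↦ ‖f w‖ₑ)] at hweak
    have hpow : ENNReal.ofReal (t ^ (p - 1)) =
        ENNReal.ofReal t * ENNReal.ofReal (t ^ (p - 1 - 1)) := by
      rw [← ENNReal.ofReal_mul ht0.le, Real.rpow_sub_one ht0.ne' (p - 1), mul_div_cancel₀ _ ht0.ne']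
    calc μ {x | t < (M x).toReal} * ENNReal.ofReal (t ^ (p - 1))
        ≤ μ {x | ENNReal.ofReal t < M x} * ENNReal.ofReal (t ^ (p - 1)) := by gcongr
      _ = ENNReal.ofReal t * μ {x | ENNReal.ofReal t < M x} * ENNReal.ofReal (t ^ (p - 1 - 1)) := by
          rw [hpow]; ring
      _ ≤ 2 * ν {x | t < 2 * ‖f x‖} * ENNReal.ofReal (t ^ (p - 1 - 1)) := by gcongr
      _ = _ := mul_assoc ..
  have hpos : ENNReal.ofReal (p - 1) ≠ 0 := by simpa using hp
  have h2' : ∫⁻ t in Ioi (0 : ℝ), ν {x | t < 2 * ‖f x‖} * ENNReal.ofReal (t ^ (p - 1 - 1)) =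
      (ENNReal.ofReal (p - 1))⁻¹ * (ENNReal.ofReal (2 ^ (p - 1)) * ∫⁻ x, ‖f x‖ₑ ^ p ∂μ) := by
    rw [← h2, ← mul_assoc, ENNReal.inv_mul_cancel hpos ENNReal.ofReal_ne_top, one_mul]
  have hC : (maximalConst p : ℝ≥0∞) = ENNReal.ofReal p *
      (2 * ((ENNReal.ofReal (p - 1))⁻¹ * ENNReal.ofReal (2 ^ (p - 1)))) := by
    have : Real.toNNReal (p - 1) ≠ 0 := by simpa using hp
    simp [maximalConst, ENNReal.ofReal, ENNReal.coe_inv this]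
  calc ∫⁻ x, M x ^ p ∂μ ≤ ENNReal.ofReal p * (2 * ((ENNReal.ofReal (p - 1))⁻¹ *
        (ENNReal.ofReal (2 ^ (p - 1)) * ∫⁻ x, ‖f x‖ₑ ^ p ∂μ))) := by
        rw [h1, ← h2']
        gcongr
    _ = maximalConst p * ∫⁻ x, ‖f x‖ₑ ^ p ∂μ := by rw [hC]; ring

/-- Hölder's inequality on a set: `μ(T) ⟨f⟩_T ^ p ≤ ∫ ‖f‖ ^ p`. -/
lemma measure_mul_setLAverage_rpow_le [IsFiniteMeasure μ] {E : Type*} [NormedAddCommGroup E]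
    {f : X → E} (hf : AEStronglyMeasurable f μ) {p : ℝ} (hp : 1 < p) (T : Set X) :
    μ T * (⨍⁻ w in T, ‖f w‖ₑ ∂μ) ^ p ≤ ∫⁻ x, ‖f x‖ₑ ^ p ∂μ := by
  have hp0 : 0 < p := by linarith
  rcases eq_or_ne (μ T) 0 with h0 | h0
  · simp [h0]
  have hfin := measure_ne_top μ T
  have h := eLpNorm_le_eLpNorm_mul_rpow_measure_univ (p := 1) (q := ENNReal.ofReal p)
    (by simpa using hp.le) (hf.restrict (s := T))
  rw [eLpNorm_one_eq_lintegral_enorm, eLpNorm_eq_lintegral_rpow_enorm_toReal (by simpa using hp0)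
    ENNReal.ofReal_ne_top, ENNReal.toReal_ofReal hp0.le, Measure.restrict_apply_univ,
    ENNReal.toReal_one] at h
  have h' : (∫⁻ w in T, ‖f w‖ₑ ∂μ) ^ p ≤ (∫⁻ w in T, ‖f w‖ₑ ^ p ∂μ) * μ T ^ (p - 1) := by
    refine (ENNReal.rpow_le_rpow h hp0.le).trans_eq ?_
    rw [ENNReal.mul_rpow_of_nonneg _ _ hp0.le, ← ENNReal.rpow_mul, ← ENNReal.rpow_mul,
      one_div_mul_cancel hp0.ne', ENNReal.rpow_one]
    congr 2
    field_simp
  calc μ T * (⨍⁻ w in T, ‖f w‖ₑ ∂μ) ^ p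
      = (∫⁻ w in T, ‖f w‖ₑ ∂μ) ^ p * (μ T * (μ T)⁻¹ ^ p) := by
        rw [setLAverage_eq, div_eq_mul_inv, ENNReal.mul_rpow_of_nonneg _ _ hp0.le]; ring
    _ ≤ (∫⁻ w in T, ‖f w‖ₑ ^ p ∂μ) * μ T ^ (p - 1) * (μ T * (μ T)⁻¹ ^ p) := by gcongr
    _ = ∫⁻ w in T, ‖f w‖ₑ ^ p ∂μ := by
        have : μ T ^ (p - 1) * (μ T * (μ T)⁻¹ ^ p) = 1 := by
          rw [ENNReal.inv_rpow, ← mul_assoc]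
          nth_rewrite 2 [← ENNReal.rpow_one (μ T)]
          rw [← ENNReal.rpow_add _ _ h0 hfin, sub_add_cancel]
          exact ENNReal.mul_inv_cancel (by simp [h0, hfin]) (by simp [h0, hfin])
        rw [mul_assoc, this, mul_one]
    _ ≤ ∫⁻ x, ‖f x‖ₑ ^ p ∂μ := setLIntegral_le_lintegral _ _

/-- The pointwise inequality of Hedberg: a part of the average is estimated by Hölder's
inequality, which absorbs the factor `μ(T) ^ α`, and the rest by the maximal function. -/
lemma iSup_rpow_mul_setLAverage_rpow_le [IsFiniteMeasure μ] {E : Type*} [NormedAddCommGroup E]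
    {f : X → E} (hf : AEStronglyMeasurable f μ) {α p q : ℝ} (hp : 1 < p) (hpq : p < q)
    (hα : 1 / p - 1 / q = α) (x : X) :
    (⨆ T ∈ 𝒯, ⨆ _ : x ∈ T, μ T ^ α * ⨍⁻ w in T, ‖f w‖ₑ ∂μ) ^ q ≤
      (∫⁻ x, ‖f x‖ₑ ^ p ∂μ) ^ ((q - p) / p) *
        maximalAverage μ 𝒯 (fun w ↦ ‖f w‖ₑ) x ^ p := by
  have hp0 : 0 < p := by linarith
  have hq0 : 0 < q := by linarith
  have hs : 0 ≤ (q - p) / p := div_nonneg (by linarith) hp0.le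
  have hαq : α * q = (q - p) / p := by rw [← hα]; field_simp
  rw [← ENNReal.le_rpow_inv_iff hq0]
  refine iSup₂_le fun T hT ↦ iSup_le fun hx ↦ ?_
  rw [ENNReal.le_rpow_inv_iff hq0]
  set a := ⨍⁻ w in T, ‖f w‖ₑ ∂μ with ha
  calc (μ T ^ α * a) ^ q = μ T ^ ((q - p) / p) * a ^ q := by
        rw [ENNReal.mul_rpow_of_nonneg _ _ hq0.le, ← ENNReal.rpow_mul, hαq]
    _ = (μ T * a ^ p) ^ ((q - p) / p) * a ^ p := by
        rw [ENNReal.mul_rpow_of_nonneg _ _ hs, ← ENNReal.rpow_mul, mul_assoc,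
          mul_div_cancel₀ _ hp0.ne', ← ENNReal.rpow_add_of_nonneg _ _ (by linarith) hp0.le,
          sub_add_cancel]
    _ ≤ _ := by
        gcongr
        · exact measure_mul_setLAverage_rpow_le hf hp T
        · exact le_iSup₂_of_le T hT (le_iSup_of_le hx le_rfl)

/-- The `L^p` to `L^q` bound of the fractional maximal operator of a countable laminar family. -/
lemma eLpNorm_iSup_rpow_mul_setLAverage_le [IsFiniteMeasure μ] (h𝒯 : 𝒯.Countable)
    (hlam : IsLaminar 𝒯) (hm : ∀ T ∈ 𝒯, MeasurableSet T) {E : Type*} [NormedAddCommGroup E]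
    {f : X → E} {α p q : ℝ} (hp : 1 < p) (hpq : p < q) (hα : 1 / p - 1 / q = α)
    (hf : MemLp f (ENNReal.ofReal p) μ) :
    eLpNorm (fun x ↦ ⨆ T ∈ 𝒯, ⨆ _ : x ∈ T, μ T ^ α * ⨍⁻ w in T, ‖f w‖ₑ ∂μ)
        (ENNReal.ofReal q) μ ≤
      (maximalConst p ^ (1 / q) : ℝ≥0) * eLpNorm f (ENNReal.ofReal p) μ := by
  have hp0 : 0 < p := by linarith
  have hq0 : 0 < q := by linarith
  have hint : Integrable f μ := hf.integrable (by simpa using hp.le)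
  have hMm : Measurable (maximalAverage μ 𝒯 fun w ↦ ‖f w‖ₑ) := measurable_iSup_mem h𝒯 hm _
  rw [eLpNorm_eq_lintegral_rpow_enorm_toReal (by simpa using hq0) ENNReal.ofReal_ne_top,
    eLpNorm_eq_lintegral_rpow_enorm_toReal (by simpa using hp0) ENNReal.ofReal_ne_top,
    ENNReal.toReal_ofReal hp0.le, ENNReal.toReal_ofReal hq0.le,
    ENNReal.coe_rpow_of_nonneg _ (by positivity)]
  simp only [enorm_eq_self]
  set I := ∫⁻ x, ‖f x‖ₑ ^ p ∂μ with hI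
  have key : ∫⁻ x, (⨆ T ∈ 𝒯, ⨆ _ : x ∈ T, μ T ^ α * ⨍⁻ w in T, ‖f w‖ₑ ∂μ) ^ q ∂μ ≤
      maximalConst p * I ^ (q / p) := by
    calc _ ≤ ∫⁻ x, I ^ ((q - p) / p) * maximalAverage μ 𝒯 (fun w ↦ ‖f w‖ₑ) x ^ p ∂μ :=
          lintegral_mono fun x ↦ iSup_rpow_mul_setLAverage_rpow_le hf.1 hp hpq hα x
      _ = I ^ ((q - p) / p) * ∫⁻ x, maximalAverage μ 𝒯 (fun w ↦ ‖f w‖ₑ) x ^ p ∂μ :=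
          lintegral_const_mul _ (hMm.pow_const p)
      _ ≤ I ^ ((q - p) / p) * (maximalConst p * I ^ (1 : ℝ)) := by
          rw [ENNReal.rpow_one]
          gcongr
          exact lintegral_maximalAverage_rpow_le h𝒯 hlam hm hint hp
      _ = maximalConst p * I ^ (q / p) := by
          rw [mul_left_comm, ← ENNReal.rpow_add_of_nonneg _ _
            (div_nonneg (by linarith) hp0.le) zero_le_one]
          congr 2
          field_simp
          ring
  refine (ENNReal.rpow_le_rpow key (by positivity)).trans_eq ?_
  rw [ENNReal.mul_rpow_of_nonneg _ _ (by positivity), ← ENNReal.rpow_mul]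
  congr 2
  field_simp

end Maximal

/-! ### The nearest-point projection -/

section Projection

variable {n : ℕ} {Ω : Set (Cn n)} {ε₀ : ℝ}

lemma IsProjectionRadius.nonempty_frontier (hε₀ : IsProjectionRadius Ω ε₀) :
    (frontier Ω).Nonempty := by
  by_contra h
  rw [not_nonempty_iff_eq_empty] at h
  obtain ⟨p, ⟨hp, -⟩, -⟩ := hε₀.2 0 (by simpa [h] using hε₀.1)
  simp [h] at hp

lemma isCompact_frontier_of_isBounded (hΩ : Bornology.IsBounded Ω) : IsCompact (frontier Ω) :=
  Metric.isCompact_of_isClosed_isBounded isClosed_frontier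
    (hΩ.closure.subset frontier_subset_closure)

/-- The boundary being compact, the projection is a nearest point everywhere. -/
lemma bdryProj_spec (hΩ : Bornology.IsBounded Ω) (hne : (frontier Ω).Nonempty) (z : Cn n) :
    bdryProj Ω z ∈ frontier Ω ∧ dist z (bdryProj Ω z) = infDist z (frontier Ω) := by
  have h : ∃ p, p ∈ frontier Ω ∧ dist z p = infDist z (frontier Ω) := by
    obtain ⟨p, hp, h⟩ := (isCompact_frontier_of_isBounded hΩ).exists_infDist_eq_dist hne z
    exact ⟨p, hp, h.symm⟩
  rw [bdryProj, dif_pos h]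
  exact h.choose_spec

/-- Where the nearest point is unique, the projection is Borel: it falls into a closed set `F` of
the boundary exactly when `F` is as near as the boundary. -/
lemma measurable_bdryProj_restrict (hΩ : Bornology.IsBounded Ω)
    (hε₀ : IsProjectionRadius Ω ε₀) :
    Measurable fun z : {z : Cn n // infDist z (frontier Ω) < ε₀} ↦ bdryProj Ω z := by
  have hne := hε₀.nonempty_frontier
  refine measurable_of_isClosed fun F hF ↦ ?_
  rcases (F ∩ frontier Ω).eq_empty_or_nonempty with h0 | hFne
  · convert MeasurableSet.empty
    refine eq_empty_of_forall_notMem fun z hz ↦ ?_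
    have : bdryProj Ω (z : Cn n) ∈ F ∩ frontier Ω := ⟨hz, (bdryProj_spec hΩ hne z).1⟩
    simp [h0] at this
  · have hcomp : IsCompact (F ∩ frontier Ω) :=
      (isCompact_frontier_of_isBounded hΩ).inter_left hF
    have : (fun z : {z : Cn n // infDist z (frontier Ω) < ε₀} ↦ bdryProj Ω z) ⁻¹' F =
        {z : {z : Cn n // infDist z (frontier Ω) < ε₀} |
          infDist (z : Cn n) (F ∩ frontier Ω) = infDist (z : Cn n) (frontier Ω)} := by
      ext ⟨z, hz⟩
      have hspec := bdryProj_spec hΩ hne z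
      simp only [mem_preimage, mem_ofPred_eq]
      constructor
      · intro hzF
        refine le_antisymm ?_ (infDist_le_infDist_of_subset inter_subset_right hFne)
        rw [← hspec.2]
        exact infDist_le_dist_of_mem ⟨hzF, hspec.1⟩
      · intro heq
        obtain ⟨p, hp, hdist⟩ := hcomp.exists_infDist_eq_dist hFne z
        have := (hε₀.2 z hz).unique ⟨hp.2, hdist.symm.trans heq⟩ hspec
        exact this ▸ hp.1
    rw [this]
    exact (isClosed_eq ((continuous_infDist_pt _).comp continuous_subtype_val)
      ((continuous_infDist_pt _).comp continuous_subtype_val)).measurableSet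

lemma tent_subset (S : Set (Cn n)) (l : ℝ) : tent Ω ε₀ S l ⊆ Ω := by
  unfold tent
  split_ifs
  · exact fun w hw ↦ hw.1
  · exact Subset.rfl

lemma measurableSet_tent (hΩo : IsOpen Ω) (hΩ : Bornology.IsBounded Ω)
    (hε₀ : IsProjectionRadius Ω ε₀) {S : Set (Cn n)} (hS : MeasurableSet S) (l : ℝ) :
    MeasurableSet (tent Ω ε₀ S l) := by
  have hne := hε₀.nonempty_frontier
  unfold tent
  split_ifs with hl
  · have hU : MeasurableSet {z : Cn n | infDist z (frontier Ω) < ε₀} :=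
      (isOpen_lt (continuous_infDist_pt _) continuous_const).measurableSet
    have h1 : MeasurableSet (Subtype.val ''
        ((fun z : {z : Cn n // infDist z (frontier Ω) < ε₀} ↦ bdryProj Ω z) ⁻¹' S)) :=
      hU.subtype_image (measurable_bdryProj_restrict hΩ hε₀ hS)
    have h2 : MeasurableSet {z : Cn n | infDist z (frontier Ω) ≤ l} :=
      (isClosed_le (continuous_infDist_pt _) continuous_const).measurableSet
    convert hΩo.measurableSet.inter (h1.inter h2) using 1
    ext z
    have hd : dist (bdryProj Ω z) z = infDist z (frontier Ω) := by
      rw [dist_comm, (bdryProj_spec hΩ hne z).2]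
    simp only [mem_ofPred_eq, mem_inter_iff, mem_image, mem_preimage, Subtype.exists,
      exists_and_left, hd]
    refine and_congr_right fun _ ↦ ⟨fun h ↦ ⟨⟨z, h.1, h.2.trans_lt hl, rfl⟩, h.2⟩, ?_⟩
    rintro ⟨⟨w, hw, -, rfl⟩, h⟩
    exact ⟨hw, h⟩
  · exact hΩo.measurableSet

lemma tent_subset_tent {S S' : Set (Cn n)} {l l' : ℝ} (hS : S ⊆ S') (hl : l ≤ l') :
    tent Ω ε₀ S l ⊆ tent Ω ε₀ S' l' := by
  by_cases h' : l' < ε₀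
  · rw [tent, tent, if_pos h', if_pos (hl.trans_lt h')]
    exact fun w hw ↦ ⟨hw.1, hS hw.2.1, hw.2.2.trans hl⟩
  · refine (tent_subset S l).trans ?_
    rw [tent, if_neg h']

end Projection

/-! ### The laminar family of tents -/

section Tents

variable {n : ℕ} [NeZero n] {Ω : Set (Cn n)} {ρ : Cn n → ℝ} {P : PolydiscSystem Ω ρ}
  (G : DyadicGrid P)

namespace DyadicGrid

/-- Two cubes of one generation, one inside the other, coincide: otherwise a child of the smaller
one would have two parents. -/
lemma eq_of_subset {k : ℕ} {Q Q' : Set (Cn n)} (hQ : Q ∈ G.cubes k) (hQ' : Q' ∈ G.cubes k)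
    (h : Q ⊆ Q') : Q = Q' := by
  obtain ⟨R, hR, hRQ⟩ := G.exists_child k Q hQ
  exact (G.unique_parent k R hR).unique ⟨hQ, hRQ⟩ ⟨hQ', hRQ.trans h⟩

lemma exists_ancestor {k l : ℕ} (hkl : k ≤ l) {Q : Set (Cn n)} (hQ : Q ∈ G.cubes l) :
    ∃ R ∈ G.cubes k, Q ⊆ R := by
  induction l, hkl using Nat.le_induction generalizing Q with
  | base => exact ⟨Q, hQ, Subset.rfl⟩
  | succ l _ ih =>
    obtain ⟨R, ⟨hR, hQR⟩, -⟩ := G.unique_parent l Q hQ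
    obtain ⟨R', hR', h⟩ := ih hR
    exact ⟨R', hR', hQR.trans h⟩

/-- Of two cubes that meet, the one of the later generation is the smaller one. -/
lemma subset_of_inter_nonempty {k l : ℕ} (hkl : k ≤ l) {Q R : Set (Cn n)}
    (hQ : Q ∈ G.cubes k) (hR : R ∈ G.cubes l) (h : (Q ∩ R).Nonempty) : R ⊆ Q := by
  rcases G.nested k l Q hQ R hR h with h | h
  · obtain ⟨R', hR', hRR'⟩ := G.exists_ancestor hkl hR
    rwa [G.eq_of_subset hQ hR' (h.trans hRR')]
  · exact h

end DyadicGrid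

lemma countable_dyadicExtension (ε₀ : ℝ) : (dyadicExtension G ε₀).Countable := by
  have h : dyadicExtension G ε₀ ⊆
      {Ω} ∪ ⋃ k, (fun Q ↦ tent Ω ε₀ Q (G.δ ^ k)) '' G.cubes k := by
    rintro T (rfl | ⟨k, -, Q, hQ, rfl⟩)
    · exact Or.inl rfl
    · exact Or.inr (mem_iUnion.2 ⟨k, Q, hQ, rfl⟩)
  exact ((countable_singleton Ω).union (countable_iUnion fun k ↦
    ((G.finite_cubes k).countable.image _))).mono h

lemma subset_of_mem_dyadicExtension {ε₀ : ℝ} {T : Set (Cn n)} (hT : T ∈ dyadicExtension G ε₀) :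
    T ⊆ Ω := by
  rcases hT with rfl | ⟨k, -, Q, -, rfl⟩
  · exact Subset.rfl
  · exact tent_subset _ _

lemma measurableSet_of_mem_dyadicExtension (hΩo : IsOpen Ω) (hΩ : Bornology.IsBounded Ω)
    {ε₀ : ℝ} (hε₀ : IsProjectionRadius Ω ε₀) {T : Set (Cn n)}
    (hT : T ∈ dyadicExtension G ε₀) : MeasurableSet T := by
  rcases hT with rfl | ⟨k, -, Q, hQ, rfl⟩
  · exact hΩo.measurableSet
  · exact measurableSet_tent hΩo hΩ hε₀ (G.measurableSet_cube k Q hQ) _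

/-- A tent over a cube of a later generation lies in any tent over an earlier one that it meets. -/
lemma tent_cube_subset {ε₀ : ℝ} {k l : ℕ} (hkl : k ≤ l) {Q R : Set (Cn n)}
    (hQ : Q ∈ G.cubes k) (hR : R ∈ G.cubes l)
    (h : (tent Ω ε₀ Q (G.δ ^ k) ∩ tent Ω ε₀ R (G.δ ^ l)).Nonempty) :
    tent Ω ε₀ R (G.δ ^ l) ⊆ tent Ω ε₀ Q (G.δ ^ k) := by
  have hδ : G.δ ^ l ≤ G.δ ^ k := pow_le_pow_of_le_one G.δ_pos.le G.δ_lt_one.le hkl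
  by_cases hk : G.δ ^ k < ε₀
  · obtain ⟨w, hwQ, hwR⟩ := h
    rw [tent, if_pos hk] at hwQ
    rw [tent, if_pos (hδ.trans_lt hk)] at hwR
    exact tent_subset_tent (G.subset_of_inter_nonempty hkl hQ hR ⟨_, hwQ.2.1, hwR.2.1⟩) hδ
  · refine (tent_subset _ _).trans ?_
    rw [tent, if_neg hk]

lemma isLaminar_dyadicExtension (ε₀ : ℝ) : IsLaminar (dyadicExtension G ε₀) := by
  intro S hS T hT hne
  have hSΩ := subset_of_mem_dyadicExtension G hS
  have hTΩ := subset_of_mem_dyadicExtension G hT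
  rcases hS with rfl | ⟨k, -, Q, hQ, rfl⟩
  · exact Or.inr hTΩ
  rcases hT with rfl | ⟨l, -, R, hR, rfl⟩
  · exact Or.inl hSΩ
  rcases le_total k l with hkl | hkl
  · exact Or.inr (tent_cube_subset G hkl hQ hR hne)
  · exact Or.inl (tent_cube_subset G hkl hR hQ (inter_comm _ _ ▸ hne))

/-- The members of the family being measurable subsets of `Ω`, Lebesgue measure may be replaced
by its restriction to `Ω`, which is finite. -/
lemma fractionalMaximal_dyadicExtension_eq (hΩo : IsOpen Ω) (hΩ : Bornology.IsBounded Ω)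
    {ε₀ : ℝ} (hε₀ : IsProjectionRadius Ω ε₀) (α : ℝ) (f : Cn n → ℂ) :
    fractionalMaximal (dyadicExtension G ε₀) α f = fun z ↦
      ⨆ T ∈ dyadicExtension G ε₀, ⨆ _ : z ∈ T, volume.restrict Ω T ^ α *
        ⨍⁻ w in T, ‖f w‖ₑ ∂volume.restrict Ω := by
  ext z
  refine iSup_congr fun T ↦ iSup_congr fun hT ↦ iSup_congr fun _ ↦ ?_
  have hTΩ := subset_of_mem_dyadicExtension G hT
  have hTm := measurableSet_of_mem_dyadicExtension G hΩo hΩ hε₀ hT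
  rw [Measure.restrict_restrict hTm, Measure.restrict_apply hTm, inter_eq_left.2 hTΩ]

end Tents

end StrictlyPseudoconvex

theorem mainTheorem11 {n : ℕ} [NeZero n] (Ω : Set (StrictlyPseudoconvex.Cn n))
    (hΩ : StrictlyPseudoconvex.IsSmoothBoundedStrictlyPseudoconvex Ω)
    (ρ : StrictlyPseudoconvex.Cn n → ℝ)
    (hρ : StrictlyPseudoconvex.IsDefiningFunction Ω ρ)
    (hρ_norm : ∀ z ∈ frontier Ω, ‖fderiv ℝ ρ z‖ = 1)
    (P : StrictlyPseudoconvex.PolydiscSystem Ω ρ)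
    (G : StrictlyPseudoconvex.DyadicGrid P)
    (ε₀ : ℝ) (hε₀ : StrictlyPseudoconvex.IsProjectionRadius Ω ε₀)
    (α p q : ℝ) (hα_pos : 0 < α) (hα_lt : α < 1) (hp : 1 < p) (hpq : p < q)
    (hαpq : 1 / p - 1 / q = α) :
    ∃ C : ℝ≥0, ∀ f : StrictlyPseudoconvex.Cn n → ℂ,
      MemLp f (ENNReal.ofReal p) (volume.restrict Ω) →
        MemLp (StrictlyPseudoconvex.fractionalMaximal
            (StrictlyPseudoconvex.dyadicExtension G ε₀) α f)
          (ENNReal.ofReal q) (volume.restrict Ω) ∧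
        eLpNorm (StrictlyPseudoconvex.fractionalMaximal
            (StrictlyPseudoconvex.dyadicExtension G ε₀) α f)
          (ENNReal.ofReal q) (volume.restrict Ω) ≤
          C * eLpNorm f (ENNReal.ofReal p) (volume.restrict Ω) := by
  have : IsFiniteMeasure (volume.restrict Ω) := ⟨by
    rw [Measure.restrict_apply_univ]; exact hΩ.isBounded.measure_lt_top⟩
  have h𝒯 := StrictlyPseudoconvex.countable_dyadicExtension G ε₀
  have hm : ∀ T ∈ StrictlyPseudoconvex.dyadicExtension G ε₀, MeasurableSet T := fun T hT ↦
    StrictlyPseudoconvex.measurableSet_of_mem_dyadicExtension G hΩ.isOpen hΩ.isBounded hε₀ hT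
  refine ⟨StrictlyPseudoconvex.maximalConst p ^ (1 / q), fun f hf ↦ ?_⟩
  have hbound := StrictlyPseudoconvex.eLpNorm_iSup_rpow_mul_setLAverage_le h𝒯
    (StrictlyPseudoconvex.isLaminar_dyadicExtension G ε₀) hm hp hpq hαpq hf
  rw [StrictlyPseudoconvex.fractionalMaximal_dyadicExtension_eq G hΩ.isOpen hΩ.isBounded hε₀]
  exact ⟨⟨(StrictlyPseudoconvex.measurable_iSup_mem h𝒯 hm _).aestronglyMeasurable,
    hbound.trans_lt (ENNReal.mul_lt_top ENNReal.coe_lt_top hf.2)⟩, hbound⟩
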